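/- For a finite weighted undirected multigraph $G$ with positive edge conductances $(c_e)_{e\in E(G)}$ and $s,t\in V(G)$, let $\mathrm{Reff}_G(s,t)\in[0,\infty]$ be the minimum of the energy $\sum_{e\in E(G)} f_e^2/c_e$ over all flows $f\in\mathbb{R}^{E(G)}$ that send one unit from $s$ to $t$, with $\mathrm{Reff}_G(s,t)=\infty$ if there is no such flow. If $G$ is connected, a random spanning tree of $G$ is a spanning tree $T$ drawn with probability proportional to $\prod_{e\in E(T)}c_e$. For every $a>0$ there is a constant $C>0$, depending only on $a$, such that the following holds. Let $G$ be a connected finite weighted multigraph with $n$ vertices, $F\subseteq E(G)$, $\epsilon\in(0,1)$, and $s,t\in V(G)$. Sample a random spanning tree $T$ of $G$, and let $H$ be the graph obtained from $G$ by contracting all edges in $E(T)\cap F$ and deleting all edges in $F\setminus E(T)$. For $F'\subseteq F$, let $H\setminus F'$ denote the graph obtained in the same way except that the edges of $F'$ are all deleted, that is, the graph obtained from $G$ by contracting the edges in $(E(T)\cap F)\setminus F'$ and deleting the edges in $(F\setminus E(T))\cup F'$; the images of $s$ and $t$ in it are again denoted $s,t$. Then, with probability at least $1-n^{-a}$, there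 is a set $F'\subseteq F$ (depending on $H$) such that $$\mathrm{Reff}_{H\setminus F'}(s,t)\ \ge\ (1-\epsilon)\,\mathrm{Reff}_G(s,t)\qquad\text{and}\qquad |F'|\ \le\ \frac{C\log n}{\epsilon^2}.$$ -/

import Mathlib

open scoped ENNReal

/-- A weighted undirected multigraph (loops and parallel edges allowed) with vertex set `V` and
edge set the finite set `edges`. The edge `e` joins `src e` and `tgt e`; which end is called the
source is an arbitrary reference orientation, used only to give flows a sign. `cond e` is the
conductance (weight) of `e`. -/
structure WeightedGraph (V E : Type*) where
  edges : Finset E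
  src : E → V
  tgt : E → V
  cond : E → ℝ
  cond_pos : ∀ e ∈ edges, 0 < cond e

namespace WeightedGraph

variable {V E : Type*}

/-- `u` and `v` are joined by a (possibly trivial) path all of whose edges lie in `A`. -/
def Joined (G : WeightedGraph V E) (A : Finset E) : V → V → Prop :=
  Relation.EqvGen fun u v => ∃ e ∈ A, e ∈ G.edges ∧ G.src e = u ∧ G.tgt e = v

/-- The equivalence relation on vertices whose classes are the components of `(V, A)`. -/
def joinedSetoid (G : WeightedGraph V E) (A : Finset E) : Setoid V :=
  Relation.EqvGen.setoid fun u v => ∃ e ∈ A, e ∈ G.edges ∧ G.src e = u ∧ G.tgt e = v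

def Connected (G : WeightedGraph V E) : Prop :=
  ∀ u v, G.Joined G.edges u v

open Classical in
/-- `T` is the edge set of a spanning tree: it connects all vertices and contains no cycle
(no edge of `T` has its ends joined by the other edges of `T`). -/
def IsSpanningTree (G : WeightedGraph V E) (T : Finset E) : Prop :=
  T ⊆ G.edges ∧ (∀ u v, G.Joined T u v) ∧
    ∀ e ∈ T, ¬ G.Joined (T.erase e) (G.src e) (G.tgt e)

open Classical in
noncomputable def spanningTrees (G : WeightedGraph V E) : Finset (Finset E) :=
  G.edges.powerset.filter G.IsSpanningTree

open Classical in
/-- The probability that `P T` holds for a random spanning tree `T`, drawn with probability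
proportional to the product of the conductances of its edges. -/
noncomputable def treeProb (G : WeightedGraph V E) (P : Finset E → Prop) : ℝ :=
  (∑ T ∈ G.spanningTrees.filter P, ∏ e ∈ T, G.cond e) /
    ∑ T ∈ G.spanningTrees, ∏ e ∈ T, G.cond e

open Classical in
/-- Delete the edges in `D`. -/
noncomputable def delete (G : WeightedGraph V E) (D : Finset E) : WeightedGraph V E where
  edges := G.edges \ D
  src := G.src
  tgt := G.tgt
  cond := G.cond
  cond_pos e he := G.cond_pos e (Finset.mem_sdiff.mp he).1

open Classical in
/-- Contract the edges in `A`: the ends of each such edge are identified and the edge removed. -/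
noncomputable def contract (G : WeightedGraph V E) (A : Finset E) :
    WeightedGraph (Quotient (G.joinedSetoid A)) E where
  edges := G.edges \ A
  src e := Quotient.mk _ (G.src e)
  tgt e := Quotient.mk _ (G.tgt e)
  cond := G.cond
  cond_pos e he := G.cond_pos e (Finset.mem_sdiff.mp he).1

open Classical in
/-- `f` sends one unit of flow from `s` to `t`: at each vertex the net outflow is
`[v = s] - [v = t]`. -/
def IsUnitFlow (G : WeightedGraph V E) (s t : V) (f : E → ℝ) : Prop :=
  ∀ v, (∑ e ∈ G.edges with G.src e = v, f e) - (∑ e ∈ G.edges with G.tgt e = v, f e) =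
    (if v = s then 1 else 0) - (if v = t then 1 else 0)

noncomputable def energy (G : WeightedGraph V E) (f : E → ℝ) : ℝ :=
  ∑ e ∈ G.edges, f e ^ 2 / G.cond e

/-- The effective resistance: the least energy of a unit flow from `s` to `t`. It is `∞` if there
is no such flow, that is, if `s` and `t` lie in different components. -/
noncomputable def Reff (G : WeightedGraph V E) (s t : V) : ℝ≥0∞ :=
  ⨅ (f : E → ℝ) (_ : G.IsUnitFlow s t f), ENNReal.ofReal (G.energy f)

open Classical in
/-- The graph `H ∖ F'`, where `H` arises from `G` by contracting the edges of `T ∩ F` and deleting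
those of `F ∖ T`: the edges of `F' ⊆ F` are deleted, the other edges of `T ∩ F` contracted, and
the other edges of `F ∖ T` deleted. For `F' = ∅` this is `H` itself. -/
noncomputable abbrev conditionDelete (G : WeightedGraph V E) (F T F' : Finset E) :
    WeightedGraph
      (Quotient ((G.delete ((F \ T) ∪ F')).joinedSetoid ((T ∩ F) \ F'))) E :=
  (G.delete ((F \ T) ∪ F')).contract ((T ∩ F) \ F')

end WeightedGraph

/-!
Expose the edges of `F` one at a time: contract an edge if it lies in the random tree `T`, delete
it otherwise. By Kirchhoff's formula the effective resistance is `R = Φ / Z`, where `Z` and `Φ` are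
the weighted numbers of spanning trees and of spanning two-forests separating `s` from `t`. The
covariance between `R` and the fate of an edge is given by the energy of that edge in the unit
current from `s` to `t`, so among `k` edges there is one for which it is at most `R / k`. While
that edge is exposed, `R ^ (-l)` is a supermartingale up to a factor `exp (48 * (l / k) ^ 2)`,
provided that both alternatives have probability bounded from below. To ensure this, only half of
the likelier alternative is split off: what remains is the same network with the conductance of the
edge doubled or halved, and the procedure is repeated there.

As these factors telescope, exposing all but the last `m` edges costs `exp (48 * l ^ 2 / m)`. The
last `m` edges are deleted, which cannot decrease the resistance. Markov's inequality with `l` of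
order `ε * m` gives a failure probability exponentially small in `ε ^ 2 * m`.
-/

namespace WeightedGraph

variable {V E : Type*}

/-! ### Potentials and components -/

section Potentials

variable {G : WeightedGraph V E} {A B : Finset E} {φ ψ : V → ℝ}

/-- The difference of a potential along an edge, in the reference orientation. -/
noncomputable def drop (G : WeightedGraph V E) (e : E) : (V → ℝ) →ₗ[ℝ] ℝ :=
  LinearMap.proj (R := ℝ) (φ := fun _ => ℝ) (G.src e) - LinearMap.proj (G.tgt e)

@[simp]
lemma drop_apply (G : WeightedGraph V E) (e : E) (φ : V → ℝ) :
    G.drop e φ = φ (G.src e) - φ (G.tgt e) := rfl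

/-- The potential `φ` is constant along every edge of `A`: it descends to the graph in which `A` is
contracted. -/
def FlatOn (G : WeightedGraph V E) (A : Finset E) (φ : V → ℝ) : Prop :=
  ∀ e ∈ A, G.drop e φ = 0

lemma FlatOn.mono (hφ : G.FlatOn B φ) (hAB : A ⊆ B) : G.FlatOn A φ :=
  fun e he => hφ e (hAB he)

lemma FlatOn.sub_smul (hφ : G.FlatOn A φ) (hψ : G.FlatOn A ψ) (r : ℝ) :
    G.FlatOn A (φ - r • ψ) := fun e he => by
  rw [map_sub, map_smul, hφ e he, hψ e he, smul_zero, sub_zero]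

lemma flatOn_insert [DecidableEq E] {e : E} :
    G.FlatOn (insert e A) φ ↔ G.drop e φ = 0 ∧ G.FlatOn A φ :=
  Finset.forall_mem_insert _ _ _

lemma Joined.eq_of_flatOn {u v : V} (h : G.Joined A u v) (hφ : G.FlatOn A φ) : φ u = φ v := by
  induction h with
  | rel x y h =>
    obtain ⟨e, he, -, rfl, rfl⟩ := h
    exact sub_eq_zero.mp (hφ e he)
  | refl x => rfl
  | symm x y _ ih => exact ih.symm
  | trans x y z _ _ ih ih' => exact ih.trans ih'

open Classical in
/-- The indicator function of the component of `u` in `(V, A)`. -/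
noncomputable def compIndicator (G : WeightedGraph V E) (A : Finset E) (u : V) : V → ℝ :=
  fun v => if G.Joined A u v then 1 else 0

lemma compIndicator_eq_one {u v : V} (h : G.Joined A u v) : G.compIndicator A u v = 1 :=
  if_pos h

lemma compIndicator_eq_zero {u v : V} (h : ¬ G.Joined A u v) : G.compIndicator A u v = 0 :=
  if_neg h

lemma compIndicator_self (u : V) : G.compIndicator A u u = 1 :=
  compIndicator_eq_one (.refl u)

lemma joined_of_compIndicator_eq_one {u v : V} (h : G.compIndicator A u v = 1) :
    G.Joined A u v := by
  by_contra hv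
  exact zero_ne_one ((compIndicator_eq_zero hv).symm.trans h)

lemma flatOn_compIndicator (hA : A ⊆ G.edges) (u : V) : G.FlatOn A (G.compIndicator A u) := by
  intro e he
  have hjoin : G.Joined A (G.src e) (G.tgt e) := .rel _ _ ⟨e, he, hA he, rfl, rfl⟩
  have hiff : G.Joined A u (G.src e) ↔ G.Joined A u (G.tgt e) :=
    ⟨fun h => h.trans _ _ _ hjoin, fun h => h.trans _ _ _ (hjoin.symm _ _)⟩
  classical exact sub_eq_zero.mpr (if_congr hiff rfl rfl)

lemma drop_compIndicator_sq {e : E} {u : V} (h : G.drop e (G.compIndicator A u) ≠ 0) :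
    G.drop e (G.compIndicator A u) ^ 2 = 1 := by
  revert h
  simp only [drop_apply, compIndicator]
  split_ifs <;> norm_num

lemma joined_of_forall_flatOn (hA : A ⊆ G.edges) {u v : V}
    (h : ∀ φ, G.FlatOn A φ → φ u = φ v) : G.Joined A u v :=
  joined_of_compIndicator_eq_one <|
    (h _ (flatOn_compIndicator hA u)).symm.trans (compIndicator_self u)

end Potentials

/-! ### Spanning trees and spanning two-forests -/

section Trees

variable {G : WeightedGraph V E} {T Y : Finset E} {φ : V → ℝ} {e f : E}

lemma IsSpanningTree.eq_of_flatOn (hT : G.IsSpanningTree T) (hφ : G.FlatOn T φ) (u v : V) :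
    φ u = φ v :=
  (hT.2.1 u v).eq_of_flatOn hφ

lemma Connected.exists_isSpanningTree (hG : G.Connected) : ∃ T, G.IsSpanningTree T := by
  classical
  obtain ⟨T, ⟨hTG, hT⟩, hmin⟩ := exists_minimal_of_wellFoundedLT
    (fun A => A ⊆ G.edges ∧ ∀ u v, G.Joined A u v) ⟨G.edges, subset_rfl, hG⟩
  refine ⟨T, hTG, hT, fun e he hj => ?_⟩
  have hsub : T.erase e ⊆ G.edges := (T.erase_subset e).trans hTG
  refine absurd (hmin ⟨hsub, fun u v => joined_of_forall_flatOn hsub fun φ hφ =>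
    (hT u v).eq_of_flatOn ?_⟩ (T.erase_subset e) he) (Finset.notMem_erase e T)
  rw [← Finset.insert_erase he]
  exact flatOn_insert.mpr ⟨sub_eq_zero.mpr (hj.eq_of_flatOn (by convert hφ)), hφ⟩

variable [DecidableEq E]

lemma IsSpanningTree.not_joined_erase (hT : G.IsSpanningTree T) (he : e ∈ T) :
    ¬ G.Joined (T.erase e) (G.src e) (G.tgt e) := by
  convert hT.2.2 e he

lemma IsSpanningTree.flatOn_compIndicator_erase (hT : G.IsSpanningTree T) (e : E) (u : V) :
    G.FlatOn (T.erase e) (G.compIndicator (T.erase e) u) :=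
  flatOn_compIndicator ((T.erase_subset e).trans hT.1) u

lemma IsSpanningTree.drop_compIndicator_erase_ne_zero (hT : G.IsSpanningTree T) (he : e ∈ T)
    (u : V) : G.drop e (G.compIndicator (T.erase e) u) ≠ 0 := by
  intro h0
  have hflat : G.FlatOn T (G.compIndicator (T.erase e) u) := by
    rw [← Finset.insert_erase he]
    exact flatOn_insert.mpr (by
      rw [Finset.insert_erase he]
      exact ⟨h0, hT.flatOn_compIndicator_erase e u⟩)
  have hjoin (v : V) : G.Joined (T.erase e) u v :=
    joined_of_compIndicator_eq_one ((hT.eq_of_flatOn hflat v u).trans (compIndicator_self u))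
  exact hT.not_joined_erase he (((hjoin _).symm _ _).trans _ _ _ (hjoin _))

lemma isSpanningTree_of_potentials (hT : T ⊆ G.edges)
    (hconst : ∀ φ, G.FlatOn T φ → ∀ u v, φ u = φ v)
    (hcut : ∀ e ∈ T, ∃ χ, G.FlatOn (T.erase e) χ ∧ G.drop e χ ≠ 0) : G.IsSpanningTree T := by
  refine ⟨hT, fun u v => joined_of_forall_flatOn hT fun φ hφ => hconst φ hφ u v, fun e he hj => ?_⟩
  obtain ⟨χ, hχ, hχe⟩ := hcut e he
  exact hχe (sub_eq_zero.mpr (hj.eq_of_flatOn (by convert hχ)))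

/-- Exchange across a cut, given as a potential that is flat on the rest of the tree. -/
lemma IsSpanningTree.exchange {χ : V → ℝ} (hT : G.IsSpanningTree (insert e Y)) (hf : f ∈ G.edges)
    (hχ : G.FlatOn Y χ) (hχe : G.drop e χ ≠ 0) (hχf : G.drop f χ ≠ 0) :
    G.IsSpanningTree (insert f Y) := by
  have hY : Y ⊆ insert e Y := Finset.subset_insert e Y
  have hfY : f ∉ Y := fun h => hχf (hχ f h)
  refine isSpanningTree_of_potentials (Finset.insert_subset hf (hY.trans hT.1))
    (fun φ hφ u v => ?_) (Finset.forall_mem_insert _ _ _ |>.mpr ⟨?_, fun g hg => ?_⟩)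
  · obtain ⟨hφf, hφY⟩ := flatOn_insert.mp hφ
    set a := G.drop e φ / G.drop e χ with ha
    have hconst := hT.eq_of_flatOn (flatOn_insert.mpr
      ⟨by rw [map_sub, map_smul, smul_eq_mul, ha, div_mul_cancel₀ _ hχe, sub_self],
        hφY.sub_smul hχ a⟩)
    have ha0 : a = 0 := by
      have hdrop : G.drop f (φ - a • χ) = 0 := sub_eq_zero.mpr (hconst _ _)
      rw [map_sub, map_smul, hφf, smul_eq_mul, zero_sub, neg_eq_zero] at hdrop
      exact (mul_eq_zero.mp hdrop).resolve_right hχf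
    simpa only [ha0, zero_smul, sub_zero] using hconst u v
  · exact ⟨χ, by rwa [Finset.erase_insert hfY], hχf⟩
  · set η := G.compIndicator ((insert e Y).erase g) (G.src e)
    have hη : G.FlatOn ((insert e Y).erase g) η := hT.flatOn_compIndicator_erase g _
    have hηg : G.drop g η ≠ 0 := hT.drop_compIndicator_erase_ne_zero (hY hg) _
    refine ⟨η - (G.drop f η / G.drop f χ) • χ, fun k hk => ?_, ?_⟩
    · obtain ⟨hkg, hk⟩ := Finset.mem_erase.mp hk
      rw [map_sub, map_smul, smul_eq_mul]
      rcases Finset.mem_insert.mp hk with rfl | hk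
      · rw [div_mul_cancel₀ _ hχf, sub_self]
      · rw [hχ k hk, hη k (Finset.mem_erase.mpr ⟨hkg, hY hk⟩), mul_zero, sub_zero]
    · rwa [map_sub, map_smul, hχ g hg, smul_zero, sub_zero]

/-- The fundamental cuts of a spanning tree form a basis of the potentials modulo constants. -/
lemma IsSpanningTree.sub_eq_sum_cut (hT : G.IsSpanningTree T) (ψ : V → ℝ) (u s t : V) :
    ψ s - ψ t = ∑ e ∈ T, (G.compIndicator (T.erase e) u s - G.compIndicator (T.erase e) u t) *
      G.drop e (G.compIndicator (T.erase e) u) * G.drop e ψ := by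
  set χ : E → V → ℝ := fun e => G.compIndicator (T.erase e) u
  set φ := ψ - ∑ e ∈ T, (G.drop e (χ e) * G.drop e ψ) • χ e with hφ
  have hflat : G.FlatOn T φ := by
    intro g hg
    have hother : ∀ e ∈ T, e ≠ g → G.drop e (χ e) * G.drop e ψ * G.drop g (χ e) = 0 := by
      intro e _ heg
      rw [hT.flatOn_compIndicator_erase e u g (Finset.mem_erase.mpr ⟨heg.symm, hg⟩), mul_zero]
    have hsq : G.drop g (χ g) ^ 2 = 1 :=
      drop_compIndicator_sq (hT.drop_compIndicator_erase_ne_zero hg u)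
    simp only [hφ, map_sub, map_sum, map_smul, smul_eq_mul]
    rw [Finset.sum_eq_single_of_mem g hg hother]
    linear_combination -G.drop g ψ * hsq
  have hconst := hT.eq_of_flatOn hflat s t
  simp only [hφ, Pi.sub_apply, Finset.sum_apply, Pi.smul_apply, smul_eq_mul] at hconst
  rw [sub_eq_sub_iff_sub_eq_sub, ← Finset.sum_sub_distrib] at hconst
  rw [hconst]
  exact Finset.sum_congr rfl fun e _ => by ring

/-- `Y` is the edge set of a spanning forest with two components, one containing `s` and the other
`t`. It is encoded as a spanning tree without one of its edges. -/
def IsTwoForest (G : WeightedGraph V E) (s t : V) (Y : Finset E) : Prop :=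
  ¬ G.Joined Y s t ∧ ∃ e ∉ Y, G.IsSpanningTree (insert e Y)

lemma isTwoForest_src_tgt_iff (he : e ∈ G.edges) :
    G.IsTwoForest (G.src e) (G.tgt e) Y ↔ e ∉ Y ∧ G.IsSpanningTree (insert e Y) := by
  constructor
  · rintro ⟨hsep, g, -, hT⟩
    have hY : Y ⊆ G.edges := (Finset.subset_insert g Y).trans hT.1
    have heY : e ∉ Y := fun h => hsep (.rel _ _ ⟨e, h, he, rfl, rfl⟩)
    have hflat := flatOn_compIndicator hY (G.src e)
    refine ⟨heY, hT.exchange he hflat (fun hg0 => hsep ?_) (fun he0 => hsep ?_)⟩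
    · exact joined_of_compIndicator_eq_one <|
        (hT.eq_of_flatOn (flatOn_insert.mpr ⟨hg0, hflat⟩) _ (G.src e)).trans (compIndicator_self _)
    · exact joined_of_compIndicator_eq_one <|
        (sub_eq_zero.mp he0).symm.trans (compIndicator_self _)
  · rintro ⟨heY, hT⟩
    refine ⟨?_, e, heY, hT⟩
    simpa only [Finset.erase_insert heY] using hT.not_joined_erase (Finset.mem_insert_self e Y)

open Classical in
/-- Adding to a two-forest an edge between its two components gives a spanning tree, and all edges
that cross the cut arise in this way. -/
lemma ite_isTwoForest_mul_drop_compIndicator {s t : V} (hf : f ∈ G.edges) (hfY : f ∉ Y) :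
    (if G.IsTwoForest s t Y then G.drop f (G.compIndicator Y s) else 0) =
      if G.IsSpanningTree (insert f Y) then (G.compIndicator Y s s - G.compIndicator Y s t) *
        G.drop f (G.compIndicator Y s) else 0 := by
  by_cases hst : G.Joined Y s t
  · rw [if_neg fun h => h.1 hst, compIndicator_eq_one hst, compIndicator_self, sub_self, zero_mul,
      ite_self]
  rw [compIndicator_self, compIndicator_eq_zero hst, sub_zero, one_mul]
  by_cases hdrop : G.drop f (G.compIndicator Y s) = 0
  · rw [hdrop, ite_self, ite_self]
  refine if_congr ⟨fun ⟨_, e, _, hT⟩ => ?_, fun hT => ⟨hst, f, hfY, hT⟩⟩ rfl rfl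
  have hflat := flatOn_compIndicator ((Finset.subset_insert e Y).trans hT.1) s
  refine hT.exchange hf hflat (fun he => hdrop ?_) hdrop
  exact sub_eq_zero.mpr (hT.eq_of_flatOn (flatOn_insert.mpr ⟨he, hflat⟩) _ _)

end Trees

/-! ### Sums over the sets between `K` and `K ∪ U` -/

open Classical in
/-- The weighted number of sets `T` with `K ⊆ T ⊆ K ∪ U` that satisfy `P`. The weight of `T` does
not include the edges of `K`, so that contracting an edge `e` turns `(K, U)` into
`(insert e K, U.erase e)`. -/
noncomputable def extensionWeight [DecidableEq E] (c : E → ℝ) (P : Finset E → Prop)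
    (K U : Finset E) : ℝ :=
  ∑ X ∈ U.powerset, if P (K ∪ X) then ∏ e ∈ X, c e else 0

section ExtensionWeight

variable [DecidableEq E] {c : E → ℝ} {P Q : Finset E → Prop} {K U : Finset E} {e : E}

lemma extensionWeight_insert (c : E → ℝ) (P : Finset E → Prop) (K : Finset E) (he : e ∉ U) :
    extensionWeight c P K (insert e U) =
      extensionWeight c P K U + c e * extensionWeight c P (insert e K) U := by
  unfold extensionWeight
  rw [Finset.sum_powerset_insert he, Finset.mul_sum]
  congr 1
  refine Finset.sum_congr rfl fun X hX => ?_
  rw [Finset.prod_insert fun h => he (Finset.mem_powerset.mp hX h), Finset.union_insert,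
    Finset.insert_union, mul_ite, mul_zero]

lemma extensionWeight_congr {c' : E → ℝ} {K' : Finset E} (hc : ∀ e ∈ U, c e = c' e)
    (hPQ : ∀ X ⊆ U, P (K ∪ X) ↔ Q (K' ∪ X)) :
    extensionWeight c P K U = extensionWeight c' Q K' U := by
  classical
  refine Finset.sum_congr rfl fun X hX => ?_
  have hX := Finset.mem_powerset.mp hX
  exact if_congr (hPQ X hX) (Finset.prod_congr rfl fun e he => hc e (hX he)) rfl

lemma extensionWeight_update_insert (P : Finset E → Prop) (K : Finset E) (he : e ∉ U) (a : ℝ) :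
    extensionWeight (Function.update c e a) P K (insert e U) =
      extensionWeight c P K U + a * extensionWeight c P (insert e K) U := by
  have hc : ∀ f ∈ U, Function.update c e a f = c f := fun f hf =>
    Function.update_of_ne (ne_of_mem_of_not_mem hf he) a c
  rw [extensionWeight_insert _ _ _ he, Function.update_self,
    extensionWeight_congr hc fun X _ => Iff.rfl, extensionWeight_congr hc fun X _ => Iff.rfl]

lemma extensionWeight_eq_zero (hP : ∀ X ⊆ U, ¬ P (K ∪ X)) : extensionWeight c P K U = 0 :=
  Finset.sum_eq_zero fun X hX => if_neg (hP X (Finset.mem_powerset.mp hX))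

lemma extensionWeight_mono (hc : ∀ e ∈ U, 0 ≤ c e) (hPQ : ∀ X ⊆ U, P (K ∪ X) → Q (K ∪ X)) :
    extensionWeight c P K U ≤ extensionWeight c Q K U := by
  refine Finset.sum_le_sum fun X hX => ?_
  have hX := Finset.mem_powerset.mp hX
  have hprod : 0 ≤ ∏ e ∈ X, c e := Finset.prod_nonneg fun e he => hc e (hX he)
  split_ifs with hP hQ
  exacts [le_rfl, absurd (hPQ X hX hP) hQ, hprod, le_rfl]

lemma extensionWeight_nonneg (hc : ∀ e ∈ U, 0 ≤ c e) : 0 ≤ extensionWeight c P K U := by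
  rw [← extensionWeight_eq_zero (c := c) (P := fun _ => False) (K := K) fun _ _ => id]
  exact extensionWeight_mono hc fun _ _ => False.elim

lemma extensionWeight_pos_iff (hc : ∀ e ∈ U, 0 < c e) :
    0 < extensionWeight c P K U ↔ ∃ X ⊆ U, P (K ∪ X) := by
  constructor
  · intro h
    by_contra! hX
    exact h.ne' (extensionWeight_eq_zero hX)
  · rintro ⟨X, hX, hP⟩
    refine Finset.sum_pos' (fun Y hY => ?_) ⟨X, Finset.mem_powerset.mpr hX, ?_⟩
    · have hY := Finset.mem_powerset.mp hY
      split_ifs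
      exacts [Finset.prod_nonneg fun e he => (hc e (hY he)).le, le_rfl]
    · rw [if_pos hP]
      exact Finset.prod_pos fun e he => hc e (hX he)

lemma sum_powerset_insert_eq (he : e ∈ U) (a : Finset E → ℝ) :
    ∑ X ∈ U.powerset with e ∉ X, a (insert e X) = ∑ X ∈ U.powerset with e ∈ X, a X := by
  refine Finset.sum_nbij' (insert e) (Finset.erase · e) ?_ ?_ ?_ ?_ fun _ _ => rfl
  all_goals simp only [Finset.mem_filter, Finset.mem_powerset, and_imp]
  · exact fun X hX _ => ⟨Finset.insert_subset he hX, Finset.mem_insert_self e X⟩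
  · exact fun X hX _ => ⟨(X.erase_subset e).trans hX, Finset.notMem_erase e X⟩
  · exact fun X _ heX => Finset.erase_insert heX
  · exact fun X _ heX => Finset.insert_erase heX

end ExtensionWeight

/-! ### Voltages -/

section Voltage

variable {G : WeightedGraph V E} {c : E → ℝ} {K U : Finset E} {s t u v : V} {φ ψ h g : V → ℝ}

/-- The bilinear form whose diagonal is the Dirichlet energy of a potential on the edges of `U` with
conductances `c`. -/
noncomputable def dirichletForm (G : WeightedGraph V E) (c : E → ℝ) (U : Finset E) :
    (V → ℝ) →ₗ[ℝ] (V → ℝ) →ₗ[ℝ] ℝ :=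
  ∑ e ∈ U, c e • (G.drop e).smulRight (G.drop e)

lemma dirichletForm_apply (G : WeightedGraph V E) (c : E → ℝ) (U : Finset E) (φ ψ : V → ℝ) :
    G.dirichletForm c U φ ψ = ∑ e ∈ U, c e * (G.drop e φ * G.drop e ψ) := by
  simp only [dirichletForm, LinearMap.sum_apply, LinearMap.smul_apply, LinearMap.smulRight_apply,
    smul_eq_mul]

lemma dirichletForm_comm (G : WeightedGraph V E) (c : E → ℝ) (U : Finset E) (φ ψ : V → ℝ) :
    G.dirichletForm c U φ ψ = G.dirichletForm c U ψ φ := by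
  simp only [dirichletForm_apply, mul_comm (G.drop _ φ)]

lemma dirichletForm_self_nonneg (hc : ∀ e ∈ U, 0 ≤ c e) (φ : V → ℝ) :
    0 ≤ G.dirichletForm c U φ φ := by
  rw [dirichletForm_apply]
  exact Finset.sum_nonneg fun e he => mul_nonneg (hc e he) (mul_self_nonneg _)

lemma flatOn_of_dirichletForm_self_eq_zero (hc : ∀ e ∈ U, 0 < c e)
    (h0 : G.dirichletForm c U φ φ = 0) : G.FlatOn U φ := by
  rw [dirichletForm_apply, Finset.sum_eq_zero_iff_of_nonneg fun e he =>
    mul_nonneg (hc e he).le (mul_self_nonneg _)] at h0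
  exact fun e he => mul_self_eq_zero.mp ((mul_eq_zero.mp (h0 e he)).resolve_left (hc e he).ne')

/-- `h` is the potential of a unit current from `s` to `t` in the network with edges `U` and
conductances `c` in which the edges of `K` are contracted. Kirchhoff's current law is stated weakly,
against all potentials of the contracted network. -/
structure IsVoltage (G : WeightedGraph V E) (c : E → ℝ) (K U : Finset E) (s t : V)
    (h : V → ℝ) : Prop where
  flatOn : G.FlatOn K h
  apply_eq : ∀ ψ, G.FlatOn K ψ → G.dirichletForm c U h ψ = ψ s - ψ t

namespace IsVoltage

lemma reciprocity (hh : G.IsVoltage c K U s t h) (hg : G.IsVoltage c K U u v g) :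
    g s - g t = h u - h v := by
  rw [← hh.apply_eq g hg.flatOn, dirichletForm_comm, hg.apply_eq h hh.flatOn]

lemma sub_eq_sub (hh : G.IsVoltage c K U s t h) (hg : G.IsVoltage c K U s t g) :
    h s - h t = g s - g t :=
  (hh.reciprocity hg).symm

lemma sub_nonneg (hh : G.IsVoltage c K U s t h) (hc : ∀ e ∈ U, 0 ≤ c e) : 0 ≤ h s - h t := by
  rw [← hh.apply_eq h hh.flatOn]
  exact dirichletForm_self_nonneg hc h

lemma eq_of_sub_eq_zero (hh : G.IsVoltage c K U s t h) (hc : ∀ e ∈ U, 0 < c e)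
    (h0 : h s - h t = 0) (hψ : G.FlatOn K ψ) : ψ s = ψ t := by
  have hflat : G.FlatOn U h :=
    flatOn_of_dirichletForm_self_eq_zero hc ((hh.apply_eq h hh.flatOn).trans h0)
  rw [← sub_eq_zero, ← hh.apply_eq ψ hψ, dirichletForm_apply]
  exact Finset.sum_eq_zero fun e he => by rw [hflat e he, zero_mul, mul_zero]

lemma exists_mul_drop_sq_le {A : Finset E} (hh : G.IsVoltage c K U s t h)
    (hc : ∀ e ∈ U, 0 ≤ c e) (hAU : A ⊆ U) (hA : A.Nonempty) :
    ∃ e ∈ A, c e * G.drop e h ^ 2 ≤ (h s - h t) / A.card := by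
  refine Finset.exists_le_of_sum_le hA ?_
  rw [Finset.sum_const, nsmul_eq_mul, mul_div_cancel₀ _ (Nat.cast_ne_zero.mpr hA.card_ne_zero),
    ← hh.apply_eq h hh.flatOn, dirichletForm_apply]
  simp only [← sq]
  exact Finset.sum_le_sum_of_subset_of_nonneg hAU fun e he _ => mul_nonneg (hc e he) (sq_nonneg _)

lemma contract [DecidableEq E] {e : E} (heU : e ∉ U) (hh : G.IsVoltage c K (insert e U) s t h)
    (hg : G.IsVoltage c K (insert e U) (G.src e) (G.tgt e) g) (hge : G.drop e g ≠ 0) :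
    G.IsVoltage c (insert e K) U s t (h - (G.drop e h / G.drop e g) • g) where
  flatOn := flatOn_insert.mpr ⟨by
    rw [map_sub, map_smul, smul_eq_mul, div_mul_cancel₀ _ hge, sub_self],
    hh.flatOn.sub_smul hg.flatOn _⟩
  apply_eq ψ hψ := by
    obtain ⟨hψe, hψK⟩ := flatOn_insert.mp hψ
    have hform (φ : V → ℝ) : G.dirichletForm c U φ ψ = G.dirichletForm c (insert e U) φ ψ := by
      rw [dirichletForm_apply, dirichletForm_apply, Finset.sum_insert heU, hψe, mul_zero, mul_zero,
        zero_add]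
    rw [hform, map_sub, map_smul, LinearMap.sub_apply, LinearMap.smul_apply, hh.apply_eq ψ hψK,
      hg.apply_eq ψ hψK, ← drop_apply, hψe, smul_zero, sub_zero]

end IsVoltage

end Voltage

/-! ### Kirchhoff's formulas -/

section Kirchhoff

variable [DecidableEq E] {G : WeightedGraph V E} {c : E → ℝ} {K U : Finset E} {s t : V} {e : E}

open Classical in
/-- Kirchhoff's potential of a unit current from `s` to `t`: up to normalization, its value at `v`
is the weighted number of spanning two-forests that separate `s` from `t` and join `v` to `s`. -/
noncomputable def kirchhoffPotential (G : WeightedGraph V E) (c : E → ℝ) (K U : Finset E)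
    (s t : V) : V → ℝ :=
  (extensionWeight c G.IsSpanningTree K U)⁻¹ • ∑ X ∈ U.powerset,
    (if G.IsTwoForest s t (K ∪ X) then ∏ e ∈ X, c e else 0) • G.compIndicator (K ∪ X) s

lemma kirchhoffPotential_sub (G : WeightedGraph V E) (c : E → ℝ) (K U : Finset E) (s t : V) :
    G.kirchhoffPotential c K U s t s - G.kirchhoffPotential c K U s t t =
      extensionWeight c (G.IsTwoForest s t) K U / extensionWeight c G.IsSpanningTree K U := by
  simp only [kirchhoffPotential, Pi.smul_apply, Finset.sum_apply, smul_eq_mul, ← mul_sub,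
    ← Finset.sum_sub_distrib]
  rw [div_eq_inv_mul, extensionWeight]
  congr 1
  refine Finset.sum_congr rfl fun X _ => ?_
  split_ifs with hX
  · rw [compIndicator_self, compIndicator_eq_zero hX.1, sub_zero, mul_one]
  · rw [zero_mul]

lemma flatOn_kirchhoffPotential (hKU : K ∪ U ⊆ G.edges) :
    G.FlatOn K (G.kirchhoffPotential c K U s t) := by
  intro e he
  simp only [kirchhoffPotential, map_smul, map_sum]
  refine smul_eq_zero_of_right _ (Finset.sum_eq_zero fun X hX => smul_eq_zero_of_right _ ?_)
  have hKX : K ∪ X ⊆ G.edges :=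
    (Finset.union_subset_union_right (Finset.mem_powerset.mp hX)).trans hKU
  exact flatOn_compIndicator hKX s e (Finset.mem_union_left X he)

open Classical in
/-- Kirchhoff's current law for one edge: the two-forests `Y` with `f` across the cut correspond to
the spanning trees `insert f Y` through `f`. -/
lemma mul_sum_isTwoForest_drop_eq {f : E} (hKU : K ∪ U ⊆ G.edges) (hdisj : Disjoint K U)
    (hf : f ∈ U) :
    c f * ∑ X ∈ U.powerset, (if G.IsTwoForest s t (K ∪ X) then ∏ e ∈ X, c e else 0) *
        G.drop f (G.compIndicator (K ∪ X) s) =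
      ∑ X ∈ U.powerset with f ∈ X, (if G.IsSpanningTree (K ∪ X) then ∏ e ∈ X, c e else 0) *
        ((G.compIndicator ((K ∪ X).erase f) s s - G.compIndicator ((K ∪ X).erase f) s t) *
          G.drop f (G.compIndicator ((K ∪ X).erase f) s)) := by
  have hfK : f ∉ K := fun h => Finset.disjoint_left.mp hdisj h hf
  rw [← sum_powerset_insert_eq hf, Finset.mul_sum, ← Finset.sum_filter_add_sum_filter_not _ (f ∈ ·),
    Finset.sum_eq_zero, zero_add]
  · refine Finset.sum_congr rfl fun X hX => ?_
    have hfX : f ∉ X := (Finset.mem_filter.mp hX).2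
    have hfKX : f ∉ K ∪ X := Finset.notMem_union.mpr ⟨hfK, hfX⟩
    have hexch := ite_isTwoForest_mul_drop_compIndicator (s := s) (t := t)
      (hKU (Finset.mem_union_right K hf)) hfKX
    rw [Finset.union_insert, Finset.erase_insert hfKX, Finset.prod_insert hfX]
    rw [ite_zero_mul, ← mul_ite_zero, hexch, ite_zero_mul, mul_ite_zero, mul_ite_zero, mul_assoc]
  · intro X hX
    obtain ⟨hXU, hfX⟩ := Finset.mem_filter.mp hX
    have hKX : K ∪ X ⊆ G.edges :=
      (Finset.union_subset_union_right (Finset.mem_powerset.mp hXU)).trans hKU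
    rw [flatOn_compIndicator hKX s f (Finset.mem_union_right K hfX), mul_zero, mul_zero]

/-- The cuts `(K ∪ X).erase f` with `f ∈ K` do not contribute to `IsSpanningTree.sub_eq_sum_cut`. -/
lemma IsSpanningTree.sub_eq_sum_cut_of_flatOn {X : Finset E} {ψ : V → ℝ}
    (hT : G.IsSpanningTree (K ∪ X)) (hψ : G.FlatOn K ψ) (u s t : V) :
    ψ s - ψ t = ∑ e ∈ X, (G.compIndicator ((K ∪ X).erase e) u s -
      G.compIndicator ((K ∪ X).erase e) u t) * G.drop e (G.compIndicator ((K ∪ X).erase e) u) *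
        G.drop e ψ := by
  rw [hT.sub_eq_sum_cut ψ u s t]
  refine (Finset.sum_subset Finset.subset_union_right fun e he heX => ?_).symm
  rw [hψ e ((Finset.mem_union.mp he).resolve_right heX), mul_zero]

theorem isVoltage_kirchhoffPotential (hKU : K ∪ U ⊆ G.edges) (hdisj : Disjoint K U)
    (hZ : extensionWeight c G.IsSpanningTree K U ≠ 0) (s t : V) :
    G.IsVoltage c K U s t (G.kirchhoffPotential c K U s t) where
  flatOn := flatOn_kirchhoffPotential hKU
  apply_eq ψ hψ := by
    classical
    rw [kirchhoffPotential, map_smul, LinearMap.smul_apply, smul_eq_mul,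
      inv_mul_eq_iff_eq_mul₀ hZ, dirichletForm_apply]
    calc
      _ = ∑ f ∈ U, ∑ X ∈ U.powerset with f ∈ X,
          (if G.IsSpanningTree (K ∪ X) then ∏ e ∈ X, c e else 0) *
            ((G.compIndicator ((K ∪ X).erase f) s s - G.compIndicator ((K ∪ X).erase f) s t) *
              G.drop f (G.compIndicator ((K ∪ X).erase f) s) * G.drop f ψ) := by
        refine Finset.sum_congr rfl fun f hf => ?_
        simp only [map_sum, map_smul, smul_eq_mul]
        rw [← mul_assoc, mul_sum_isTwoForest_drop_eq hKU hdisj hf, Finset.sum_mul]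
        simp only [mul_assoc]
      _ = ∑ X ∈ U.powerset, ∑ f ∈ X,
          (if G.IsSpanningTree (K ∪ X) then ∏ e ∈ X, c e else 0) *
            ((G.compIndicator ((K ∪ X).erase f) s s - G.compIndicator ((K ∪ X).erase f) s t) *
              G.drop f (G.compIndicator ((K ∪ X).erase f) s) * G.drop f ψ) := by
        refine Finset.sum_comm' fun f X => ?_
        rw [Finset.mem_filter, Finset.mem_powerset]
        exact ⟨fun ⟨_, hX, hf⟩ => ⟨hf, hX⟩, fun ⟨hf, hX⟩ => ⟨hX hf, hX, hf⟩⟩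
      _ = ∑ X ∈ U.powerset,
          (if G.IsSpanningTree (K ∪ X) then ∏ e ∈ X, c e else 0) * (ψ s - ψ t) := by
        refine Finset.sum_congr rfl fun X _ => ?_
        rw [← Finset.mul_sum]
        split_ifs with hT
        · rw [← hT.sub_eq_sum_cut_of_flatOn hψ]
        · rw [zero_mul, zero_mul]
      _ = _ := by rw [← Finset.sum_mul, extensionWeight]

theorem IsVoltage.sub_eq_div {h : V → ℝ} (hh : G.IsVoltage c K U s t h) (hKU : K ∪ U ⊆ G.edges)
    (hdisj : Disjoint K U) (hZ : extensionWeight c G.IsSpanningTree K U ≠ 0) :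
    h s - h t =
      extensionWeight c (G.IsTwoForest s t) K U / extensionWeight c G.IsSpanningTree K U :=
  (hh.sub_eq_sub (isVoltage_kirchhoffPotential hKU hdisj hZ s t)).trans
    (kirchhoffPotential_sub G c K U s t)

lemma extensionWeight_isTwoForest_src_tgt (c : E → ℝ) (heG : e ∈ G.edges) (heK : e ∉ K)
    (heU : e ∉ U) :
    extensionWeight c (G.IsTwoForest (G.src e) (G.tgt e)) K (insert e U) =
      extensionWeight c G.IsSpanningTree (insert e K) U := by
  rw [extensionWeight_insert c _ K heU, extensionWeight_eq_zero fun X _ hX =>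
    ((isTwoForest_src_tgt_iff heG).mp hX).1 (Finset.mem_union_left X (Finset.mem_insert_self e K)),
    mul_zero, add_zero]
  refine extensionWeight_congr (fun _ _ => rfl) fun X hX => ?_
  rw [isTwoForest_src_tgt_iff heG, Finset.insert_union, and_iff_right]
  exact Finset.notMem_union.mpr ⟨heK, fun h => heU (hX h)⟩

lemma IsVoltage.extensionWeight_isTwoForest_insert_eq_zero {g : V → ℝ}
    (hg : G.IsVoltage c K (insert e U) (G.src e) (G.tgt e) g) (hc : ∀ f ∈ insert e U, 0 < c f)
    (heK : e ∉ K) (h0 : G.drop e g = 0) :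
    extensionWeight c (G.IsTwoForest s t) (insert e K) U = 0 := by
  refine extensionWeight_eq_zero fun X _ ⟨_, f, _, hT⟩ => ?_
  set T := insert f (insert e K ∪ X)
  have heT : e ∈ T := by simp [T]
  have hKT : K ⊆ T.erase e := fun k hk => by
    simp [T, hk, ne_of_mem_of_not_mem hk heK]
  exact hT.drop_compIndicator_erase_ne_zero heT s <| sub_eq_zero.mpr <|
    hg.eq_of_sub_eq_zero hc h0 ((hT.flatOn_compIndicator_erase e s).mono hKT)

/-- Rayleigh monotonicity in quantitative form. -/
theorem IsVoltage.extensionWeight_mul_sub_mul_eq_sq {h : V → ℝ}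
    (hh : G.IsVoltage c K (insert e U) s t h) (hKU : K ∪ insert e U ⊆ G.edges)
    (hdisj : Disjoint K (insert e U)) (heU : e ∉ U) (hc : ∀ f ∈ insert e U, 0 < c f)
    (hZ : extensionWeight c G.IsSpanningTree K (insert e U) ≠ 0) :
    extensionWeight c (G.IsTwoForest s t) K U * extensionWeight c G.IsSpanningTree (insert e K) U -
        extensionWeight c (G.IsTwoForest s t) (insert e K) U *
          extensionWeight c G.IsSpanningTree K U =
      (extensionWeight c G.IsSpanningTree K (insert e U) * G.drop e h) ^ 2 := by
  have heG : e ∈ G.edges := hKU (Finset.mem_union_right K (Finset.mem_insert_self e U))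
  have heK : e ∉ K := fun he => Finset.disjoint_left.mp hdisj he (Finset.mem_insert_self e U)
  have hg := isVoltage_kirchhoffPotential hKU hdisj hZ (G.src e) (G.tgt e)
  set g := G.kirchhoffPotential c K (insert e U) (G.src e) (G.tgt e)
  have hrecip : g s - g t = G.drop e h := hh.reciprocity hg
  have hge : G.drop e g = _ / _ := hg.sub_eq_div hKU hdisj hZ
  have hR := hh.sub_eq_div hKU hdisj hZ
  rw [extensionWeight_isTwoForest_src_tgt c heG heK heU] at hge
  by_cases h0 : G.drop e g = 0
  · have hZ₁ : extensionWeight c G.IsSpanningTree (insert e K) U = 0 :=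
      (div_eq_zero_iff.mp (hge.symm.trans h0)).resolve_right hZ
    have hhe : G.drop e h = 0 := sub_eq_zero.mpr (hg.eq_of_sub_eq_zero hc h0 hh.flatOn)
    rw [hg.extensionWeight_isTwoForest_insert_eq_zero hc heK h0, hZ₁, hhe]
    ring
  have hZ₁ : extensionWeight c G.IsSpanningTree (insert e K) U ≠ 0 := fun hZ₁ =>
    h0 (by rw [hge, hZ₁, zero_div])
  have hKU' : insert e K ∪ U ⊆ G.edges := by rwa [Finset.insert_union, ← Finset.union_insert]
  have hdisj' : Disjoint (insert e K) U :=
    Finset.disjoint_insert_left.mpr ⟨heU, hdisj.mono_right (Finset.subset_insert e U)⟩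
  have hR₁ := (hh.contract heU hg h0).sub_eq_div hKU' hdisj' hZ₁
  have hsub : (h - (G.drop e h / G.drop e g) • g) s - (h - (G.drop e h / G.drop e g) • g) t =
      (h s - h t) - G.drop e h / G.drop e g * (g s - g t) := by
    simp only [Pi.sub_apply, Pi.smul_apply, smul_eq_mul]
    ring
  rw [hsub, hrecip, hR, hge] at hR₁
  rw [extensionWeight_insert c _ K heU, extensionWeight_insert c _ K heU] at hR₁
  rw [extensionWeight_insert c _ K heU] at hZ ⊢
  field_simp at hR₁
  linear_combination hR₁

end Kirchhoff

/-! ### Exposing one edge: the analytic estimates -/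

section Analytic

variable {q δ η w l : ℝ}

lemma one_add_rpow_neg_le (hl : 1 ≤ l) (hw : l * |w| ≤ 2 / 11) :
    (1 + w) ^ (-l) ≤ 1 - l * w + 3 * (l * w) ^ 2 := by
  have hl0 : 0 < l := zero_lt_one.trans_le hl
  obtain ⟨hw1, -⟩ := abs_le.mp ((le_mul_of_one_le_left (abs_nonneg w) hl).trans hw)
  have hpos : 0 < 1 + w := by linarith
  set y := (1 + w)⁻¹ with hy
  have hy0 : 0 < y := inv_pos.mpr hpos
  have hy1 : y ≤ 11 / 9 := (inv_le_comm₀ hpos (by norm_num)).mpr (by linarith)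
  have hyw : 1 - y = w * y := by rw [hy]; field_simp; ring
  have hz : |-(l * w * y)| ≤ 1 := by
    rw [abs_neg, abs_mul, abs_mul, abs_of_pos hl0, abs_of_pos hy0]
    nlinarith
  have hlw : l * w ^ 2 ≤ (l * w) ^ 2 := by nlinarith [sq_nonneg w]
  calc (1 + w) ^ (-l) = Real.exp (Real.log (1 + w) * -l) := Real.rpow_def_of_pos hpos _
    _ ≤ Real.exp (-(l * w * y)) := by
      have hlog : w * y ≤ Real.log (1 + w) := hyw ▸ Real.one_sub_inv_le_log_of_pos hpos
      exact Real.exp_le_exp.mpr (by nlinarith)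
    _ ≤ 1 + -(l * w * y) + (-(l * w * y)) ^ 2 := by
      linarith [(abs_le.mp (Real.abs_exp_sub_one_sub_id_le hz)).2]
    _ = 1 - l * w + l * w ^ 2 * y + (l * w) ^ 2 * y ^ 2 := by linear_combination l * w * hyw
    _ ≤ 1 - l * w + (l * w) ^ 2 * (11 / 9) + (l * w) ^ 2 * (11 / 9) ^ 2 := by gcongr
    _ ≤ 1 - l * w + 3 * (l * w) ^ 2 := by linarith [sq_nonneg (l * w)]

lemma mul_one_add_div_rpow_neg_le (hq : 0 < q) (hl : 1 ≤ l) (hδ : l * |δ| ≤ 2 / 11 * q) :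
    q * (1 + δ / q) ^ (-l) ≤ q - l * δ + 3 * (l * δ) ^ 2 / q := by
  have hw : l * |δ / q| ≤ 2 / 11 := by
    rwa [abs_div, abs_of_pos hq, ← mul_div_assoc, div_le_iff₀ hq]
  refine (mul_le_mul_of_nonneg_left (one_add_rpow_neg_le hl hw) hq.le).trans_eq ?_
  field_simp

lemma exp_neg_le_one_sub_half {y : ℝ} (hy0 : 0 ≤ y) (hy1 : y ≤ 1) :
    Real.exp (-y) ≤ 1 - y / 2 := by
  rw [Real.exp_neg, inv_le_iff_one_le_mul₀ (Real.exp_pos y)]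
  nlinarith [Real.add_one_le_exp y]

/-- With weights `q` and `2 - q` the linear terms cancel, and the exponential factor absorbs the
quadratic ones. -/
lemma weighted_rpow_neg_add_le (hq1 : 1 / 2 ≤ q) (hq2 : q ≤ 1) (hδ : |δ| ≤ η) (hl : 1 ≤ l)
    (hη : l * η ≤ 1 / 11) :
    Real.exp (-(48 * (l * η) ^ 2)) * (q * (1 + δ / q) ^ (-l)) +
      (2 - q) * (1 + -δ / (2 - q)) ^ (-l) ≤ 2 := by
  set L := l * η
  have hlδ : l * |δ| ≤ L := mul_le_mul_of_nonneg_left hδ (zero_le_one.trans hl)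
  have hL0 : 0 ≤ L := (mul_nonneg (zero_le_one.trans hl) (abs_nonneg δ)).trans hlδ
  have hlδ' : |l * δ| ≤ L := by rwa [abs_mul, abs_of_nonneg (zero_le_one.trans hl)]
  have hsq : (l * δ) ^ 2 ≤ L ^ 2 := sq_le_sq' (neg_le_of_abs_le hlδ') (le_of_abs_le hlδ')
  have hfirst : q * (1 + δ / q) ^ (-l) ≤ q - l * δ + 6 * L ^ 2 := by
    refine (mul_one_add_div_rpow_neg_le (by linarith) hl (by linarith)).trans ?_
    gcongr
    rw [div_le_iff₀ (by linarith)]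
    nlinarith [sq_nonneg L]
  have hsecond : (2 - q) * (1 + -δ / (2 - q)) ^ (-l) ≤ 2 - q + l * δ + 3 * L ^ 2 := by
    refine (mul_one_add_div_rpow_neg_le (by linarith) hl (by rw [abs_neg]; linarith)).trans ?_
    rw [mul_neg, sub_neg_eq_add, neg_sq]
    gcongr
    rw [div_le_iff₀ (by linarith)]
    nlinarith [sq_nonneg L]
  have hexp : Real.exp (-(48 * L ^ 2)) ≤ 1 - 24 * L ^ 2 := by
    refine (exp_neg_le_one_sub_half (by positivity) (by nlinarith)).trans_eq (by ring)
  have hbase : 9 / 22 ≤ q - l * δ + 6 * L ^ 2 := by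
    linarith [le_of_abs_le hlδ', sq_nonneg L]
  calc _ ≤ Real.exp (-(48 * L ^ 2)) * (q - l * δ + 6 * L ^ 2) + (2 - q + l * δ + 3 * L ^ 2) := by
        gcongr
    _ ≤ (1 - 24 * L ^ 2) * (q - l * δ + 6 * L ^ 2) + (2 - q + l * δ + 3 * L ^ 2) := by gcongr
    _ ≤ 2 := by nlinarith [sq_nonneg L]

/-- The bound `M * R ^ (-l) + err` on the probability `N / Z` at resistance `R = Φ / Z`. It is void
in the degenerate cases `Z = 0` and `R = 0`. -/
def RatioBound (l M err N Z Φ : ℝ) : Prop :=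
  0 < Z → 0 < Φ → N ≤ (M * (Z / Φ) ^ l + err) * Z

lemma RatioBound.const_mul {M err N Z Φ a : ℝ} (h : RatioBound l M err N Z Φ) (ha : 0 < a) :
    RatioBound l M err (a * N) (a * Z) (a * Φ) := fun hZ hΦ => by
  rw [mul_div_mul_left _ _ ha.ne', mul_left_comm]
  exact mul_le_mul_of_nonneg_left
    (h ((mul_pos_iff_of_pos_left ha).mp hZ) ((mul_pos_iff_of_pos_left ha).mp hΦ)) ha.le

lemma div_rpow_eq_mul_one_add_div_rpow_neg {p x Z Φ : ℝ} (hp : 0 < p) (hpx : 0 < p + x)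
    (hZ : 0 ≤ Z) (hΦ : 0 ≤ Φ) :
    (p * Z / ((p + x) * Φ)) ^ l = (Z / Φ) ^ l * (1 + x / p) ^ (-l) := by
  have hpos : 0 < 1 + x / p := by rw [one_add_div hp.ne']; positivity
  rw [Real.rpow_neg hpos.le, ← Real.inv_rpow hpos.le, ← Real.mul_rpow (by positivity)
    (by positivity), one_add_div hp.ne', inv_div, mul_comm (Z / Φ), mul_div_mul_comm]

lemma RatioBound.average {M M' err n₀ n₁ Z Φ : ℝ} (hl : 1 ≤ l) (hη : l * η ≤ 1 / 11)
    (hq1 : 1 / 2 ≤ q) (hq2 : q ≤ 1) (hδ : |δ| ≤ η)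
    (hM : M ≤ M' * Real.exp (-(48 * (l * η) ^ 2))) (hM' : 0 ≤ M') (herr : 0 ≤ err)
    (h₀ : RatioBound l M 0 n₀ (q * Z) ((q + δ) * Φ))
    (h₁ : RatioBound l M' err n₁ ((2 - q) * Z) ((2 - q + -δ) * Φ)) :
    RatioBound l M' (3 / 4 * err) ((n₀ + n₁) / 2) Z Φ := by
  intro hZ hΦ
  have hη' : η ≤ 1 / 11 := (le_mul_of_one_le_left ((abs_nonneg δ).trans hδ) hl).trans hη
  obtain ⟨hδ1, hδ2⟩ := abs_le.mp (hδ.trans hη')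
  have hq : 0 < q := by linarith
  have hq' : 0 < 2 - q := by linarith
  have hqδ : 0 < q + δ := by linarith
  have hqδ' : 0 < 2 - q + -δ := by linarith
  have hn₀ := h₀ (by positivity) (by positivity)
  have hn₁ := h₁ (by positivity) (by positivity)
  rw [div_rpow_eq_mul_one_add_div_rpow_neg hq hqδ hZ.le hΦ.le, add_zero] at hn₀
  rw [div_rpow_eq_mul_one_add_div_rpow_neg hq' hqδ' hZ.le hΦ.le] at hn₁
  set ω := (Z / Φ) ^ l
  have : 0 ≤ ω := by positivity
  have ha : 0 ≤ (1 + δ / q) ^ (-l) :=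
    Real.rpow_nonneg (by rw [one_add_div hq.ne']; positivity) _
  replace hn₀ : n₀ ≤ M' * Real.exp (-(48 * (l * η) ^ 2)) * (ω * (1 + δ / q) ^ (-l)) * (q * Z) :=
    hn₀.trans (by gcongr)
  have hstep := mul_le_mul_of_nonneg_left (weighted_rpow_neg_add_le hq1 hq2 hδ hl hη)
    (by positivity : 0 ≤ M' * ω * Z)
  have herr' : err * ((2 - q) * Z) ≤ err * (3 / 2 * Z) := by gcongr; linarith
  linarith

/-- The network with data `(n₀ + n₁, z₀ + z₁, φ₀ + φ₁)` is the average of those with data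
`(n₀, z₀, φ₀)` and `(n₀ + 2 n₁, z₀ + 2 z₁, φ₀ + 2 φ₁)`. -/
lemma RatioBound.add {M M' err n₀ n₁ z₀ z₁ φ₀ φ₁ : ℝ} (hl : 1 ≤ l) (hη : l * η ≤ 1 / 11)
    (hM : M ≤ M' * Real.exp (-(48 * (l * η) ^ 2))) (hM' : 0 ≤ M') (herr : 0 ≤ err)
    (hz₁ : 0 ≤ z₁) (hz : z₁ ≤ z₀)
    (hcorr : |φ₀ * z₁ - φ₁ * z₀| ≤ η * ((z₀ + z₁) * (φ₀ + φ₁)))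
    (h₀ : RatioBound l M 0 n₀ z₀ φ₀)
    (h₁ : RatioBound l M' err (n₀ + 2 * n₁) (z₀ + 2 * z₁) (φ₀ + 2 * φ₁)) :
    RatioBound l M' (3 / 4 * err) (n₀ + n₁) (z₀ + z₁) (φ₀ + φ₁) := by
  intro hZ hΦ
  have hZΦ : 0 < (z₀ + z₁) * (φ₀ + φ₁) := mul_pos hZ hΦ
  obtain ⟨q, hq⟩ : ∃ q, q * (z₀ + z₁) = z₀ := ⟨_, div_mul_cancel₀ _ hZ.ne'⟩
  obtain ⟨δ, hδ⟩ : ∃ δ, δ * ((z₀ + z₁) * (φ₀ + φ₁)) = φ₀ * z₁ - φ₁ * z₀ :=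
    ⟨_, div_mul_cancel₀ _ hZΦ.ne'⟩
  have hδη : |δ| ≤ η := by
    rw [← hδ, abs_mul, abs_of_pos hZΦ] at hcorr
    exact le_of_mul_le_mul_right hcorr hZΦ
  have hφ₀ : (q + δ) * (φ₀ + φ₁) = φ₀ :=
    mul_right_cancel₀ hZ.ne' (by linear_combination hδ + (φ₀ + φ₁) * hq)
  have hφ₁ : (2 - q + -δ) * (φ₀ + φ₁) = φ₀ + 2 * φ₁ := by linear_combination -hφ₀
  have hz₁' : (2 - q) * (z₀ + z₁) = z₀ + 2 * z₁ := by linear_combination -hq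
  have hsum : (n₀ + (n₀ + 2 * n₁)) / 2 = n₀ + n₁ := by ring
  rw [← hsum]
  refine RatioBound.average (q := q) hl hη (le_of_mul_le_mul_right (by linarith) hZ)
    (le_of_mul_le_mul_right (by linarith) hZ) hδη hM hM' herr ?_ ?_ hZ hΦ
  · rwa [hq, hφ₀]
  · rwa [hz₁', hφ₁]

lemma RatioBound.add_of_scaled {M M' err n₀ n₁ z₀ z₁ φ₀ φ₁ : ℝ} (hl : 1 ≤ l)
    (hη : l * η ≤ 1 / 11) (hM : M ≤ M' * Real.exp (-(48 * (l * η) ^ 2))) (hM' : 0 ≤ M')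
    (herr : 0 ≤ err) (hz₀ : 0 ≤ z₀) (hz₁ : 0 ≤ z₁)
    (hcorr : |φ₀ * z₁ - φ₁ * z₀| ≤ η * ((z₀ + z₁) * (φ₀ + φ₁)))
    (h₀ : RatioBound l M 0 n₀ z₀ φ₀) (h₁ : RatioBound l M 0 n₁ z₁ φ₁)
    (h₁₀ : RatioBound l M' err (n₁ + 2 * n₀) (z₁ + 2 * z₀) (φ₁ + 2 * φ₀))
    (h₀₁ : RatioBound l M' err (n₀ + 2 * n₁) (z₀ + 2 * z₁) (φ₀ + 2 * φ₁)) :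
    RatioBound l M' (3 / 4 * err) (n₀ + n₁) (z₀ + z₁) (φ₀ + φ₁) := by
  rcases le_total z₁ z₀ with hz | hz
  · exact .add hl hη hM hM' herr hz₁ hz hcorr h₀ h₀₁
  · rw [abs_sub_comm, add_comm z₀, add_comm φ₀] at hcorr
    rw [add_comm n₀, add_comm z₀, add_comm φ₀]
    exact .add hl hη hM hM' herr hz₀ hz hcorr h₁ h₁₀

end Analytic

/-! ### Effective resistance -/

section Resistance

variable {G : WeightedGraph V E} {s t : V} {f : E → ℝ} {h φ : V → ℝ} {ρ : ℝ}

lemma sum_mul_sum_filter_eq [DecidableEq V] {A : Finset E} {S : Finset V} {p : E → V}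
    (hp : ∀ e ∈ A, p e ∈ S) (f : E → ℝ) (φ : V → ℝ) :
    ∑ v ∈ S, φ v * ∑ e ∈ A with p e = v, f e = ∑ e ∈ A, f e * φ (p e) := by
  rw [← Finset.sum_fiberwise_of_maps_to hp]
  refine Finset.sum_congr rfl fun v _ => ?_
  rw [Finset.mul_sum]
  refine Finset.sum_congr rfl fun e he => ?_
  rw [(Finset.mem_filter.mp he).2, mul_comm]

lemma IsUnitFlow.sum_mul_drop (hf : G.IsUnitFlow s t f) (φ : V → ℝ) :
    ∑ e ∈ G.edges, f e * G.drop e φ = φ s - φ t := by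
  classical
  set S := {s, t} ∪ G.edges.image G.src ∪ G.edges.image G.tgt with hS
  have hsrc : ∀ e ∈ G.edges, G.src e ∈ S := fun e he =>
    Finset.mem_union_left _ (Finset.mem_union_right _ (Finset.mem_image_of_mem _ he))
  have htgt : ∀ e ∈ G.edges, G.tgt e ∈ S := fun e he =>
    Finset.mem_union_right _ (Finset.mem_image_of_mem _ he)
  have hs : s ∈ S := by simp [hS]
  have ht : t ∈ S := by simp [hS]
  simp only [drop_apply, mul_sub, Finset.sum_sub_distrib]
  rw [← sum_mul_sum_filter_eq hsrc, ← sum_mul_sum_filter_eq htgt, ← Finset.sum_sub_distrib]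
  simp only [← mul_sub]
  have hdiv (v : V) : φ v * ((∑ e ∈ G.edges with G.src e = v, f e) -
      ∑ e ∈ G.edges with G.tgt e = v, f e) =
      (if v = s then φ v else 0) - (if v = t then φ v else 0) := by
    rw [← mul_boole (v = s), ← mul_boole (v = t), mul_comm, mul_comm _ (φ v), ← mul_sub]
    convert congrArg (φ v * ·) (hf v)
  rw [Finset.sum_congr rfl fun v _ => hdiv v, Finset.sum_sub_distrib, Finset.sum_ite_eq',
    Finset.sum_ite_eq', if_pos hs, if_pos ht]

/-- The current of a voltage is a unit flow. -/
lemma IsVoltage.Reff_le (hh : G.IsVoltage G.cond ∅ G.edges s t h) :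
    G.Reff s t ≤ ENNReal.ofReal (h s - h t) := by
  classical
  refine (iInf₂_le (fun e => G.cond e * G.drop e h) fun v => ?_).trans_eq ?_
  · have hv := hh.apply_eq (Pi.single v 1) fun e he => absurd he (Finset.notMem_empty e)
    rw [dirichletForm_apply] at hv
    simp only [Pi.single_apply, drop_apply] at hv
    simp only [eq_comm (a := v)]
    rw [← hv, Finset.sum_filter, Finset.sum_filter, ← Finset.sum_sub_distrib]
    refine Finset.sum_congr rfl fun e _ => ?_
    rw [drop_apply]
    split_ifs <;> ring
  · rw [← hh.apply_eq h hh.flatOn, dirichletForm_apply, energy]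
    congr 1
    refine Finset.sum_congr rfl fun e he => ?_
    have hce := (G.cond_pos e he).ne'
    field_simp

lemma IsUnitFlow.sq_sub_le (hf : G.IsUnitFlow s t f) (φ : V → ℝ) :
    (φ s - φ t) ^ 2 ≤ G.dirichletForm G.cond G.edges φ φ * G.energy f := by
  rw [← hf.sum_mul_drop φ, dirichletForm_apply, energy]
  refine Finset.sum_sq_le_sum_mul_sum_of_sq_le_mul _
    (fun e he => mul_nonneg (G.cond_pos e he).le (mul_self_nonneg _))
    (fun e he => div_nonneg (sq_nonneg _) (G.cond_pos e he).le) fun e he => le_of_eq ?_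
  have hce := (G.cond_pos e he).ne'
  field_simp

lemma ofReal_le_Reff (hst : φ s ≠ φ t)
    (hφ : ρ * G.dirichletForm G.cond G.edges φ φ ≤ (φ s - φ t) ^ 2) :
    ENNReal.ofReal ρ ≤ G.Reff s t := by
  refine le_iInf₂ fun f hf => ENNReal.ofReal_le_ofReal ?_
  have hnonneg : 0 ≤ G.dirichletForm G.cond G.edges φ φ :=
    dirichletForm_self_nonneg (fun e he => (G.cond_pos e he).le) φ
  have hprod : 0 < G.dirichletForm G.cond G.edges φ φ * G.energy f :=
    (sq_pos_of_ne_zero (sub_ne_zero.mpr hst)).trans_le (hf.sq_sub_le φ)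
  refine le_of_mul_le_mul_left ?_ (hnonneg.lt_of_ne' (left_ne_zero_of_mul hprod.ne'))
  exact (mul_comm _ ρ).trans_le (hφ.trans (hf.sq_sub_le φ))

lemma ofReal_le_Reff_conditionDelete [DecidableEq E] {F T F' : Finset E}
    (hflat : G.FlatOn ((T ∩ F) \ F') φ) (hst : φ s ≠ φ t)
    (hφ : ρ * G.dirichletForm G.cond (G.edges \ F) φ φ ≤ (φ s - φ t) ^ 2) (hF' : F' ⊆ F) :
    ENNReal.ofReal ρ ≤ (G.conditionDelete F T F').Reff (Quotient.mk _ s) (Quotient.mk _ t) := by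
  classical
  have hedges : (G.conditionDelete F T F').edges = G.edges \ F := by
    ext e
    have := @hF' e
    simp only [conditionDelete, contract, delete, Finset.mem_sdiff, Finset.mem_union,
      Finset.mem_inter]
    tauto
  refine ofReal_le_Reff (G := G.conditionDelete F T F') (φ := Quotient.lift φ fun u v huv => ?_)
    hst ?_
  · exact Joined.eq_of_flatOn (G := G.delete _) huv fun e he => hflat e (by convert he)
  · rw [dirichletForm_apply] at hφ ⊢
    rw [hedges]
    exact hφ

end Resistance

/-! ### Exposing the edges one by one -/

section Stage

variable [DecidableEq E] {G : WeightedGraph V E} {F K U : Finset E} {c : E → ℝ} {e : E} {s t : V}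
  {P : Finset E → Prop} {l M M' err : ℝ} {k : ℕ}

/-- The networks met while the edges of `F` are exposed: the edges of `K` are contracted, those of
`U` are still present, and the conductances of the present edges of `F` are arbitrary. -/
structure IsStage (G : WeightedGraph V E) (F : Finset E) (c : E → ℝ) (K U : Finset E) : Prop where
  union_subset : K ∪ U ⊆ G.edges
  disjoint : Disjoint K U
  sdiff_subset : G.edges \ F ⊆ U
  pos : ∀ e ∈ U, 0 < c e
  cond_eq : ∀ e ∉ F, c e = G.cond e

lemma isStage_edges (G : WeightedGraph V E) (F : Finset E) :
    G.IsStage F G.cond ∅ G.edges where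
  union_subset := (Finset.empty_union G.edges).subset
  disjoint := Finset.disjoint_empty_left _
  sdiff_subset := Finset.sdiff_subset
  pos := G.cond_pos
  cond_eq _ _ := rfl

namespace IsStage

lemma delete (hS : G.IsStage F c K (insert e U)) (heF : e ∈ F) : G.IsStage F c K U where
  union_subset := (Finset.union_subset_union_right (Finset.subset_insert e U)).trans hS.union_subset
  disjoint := hS.disjoint.mono_right (Finset.subset_insert e U)
  sdiff_subset _ hf := (Finset.mem_insert.mp (hS.sdiff_subset hf)).resolve_left
    (ne_of_mem_of_not_mem heF (Finset.mem_sdiff.mp hf).2).symm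
  pos f hf := hS.pos f (Finset.mem_insert_of_mem hf)
  cond_eq := hS.cond_eq

lemma contract (hS : G.IsStage F c K (insert e U)) (heF : e ∈ F) (heU : e ∉ U) :
    G.IsStage F c (insert e K) U where
  __ := hS.delete heF
  union_subset := by
    rw [Finset.insert_union, ← Finset.union_insert]
    exact hS.union_subset
  disjoint := Finset.disjoint_insert_left.mpr ⟨heU, (hS.delete heF).disjoint⟩

lemma update {a : ℝ} (hS : G.IsStage F c K U) (heF : e ∈ F) (ha : 0 < a) :
    G.IsStage F (Function.update c e a) K U where
  __ := hS
  pos f hf := by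
    rcases eq_or_ne f e with rfl | hfe
    · rwa [Function.update_self]
    · rw [Function.update_of_ne hfe]
      exact hS.pos f hf
  cond_eq f hf := by
    rw [Function.update_of_ne (ne_of_mem_of_not_mem heF hf).symm]
    exact hS.cond_eq f hf

/-- An edge of `F` of least energy carries at most its share of the total energy, which is the
effective resistance. -/
lemma exists_correlation_le (hS : G.IsStage F c K U) (hk : (U ∩ F).card = k + 1)
    (hZ : 0 < extensionWeight c G.IsSpanningTree K U) (s t : V) :
    ∃ e ∈ F, ∃ U', e ∉ U' ∧ U = insert e U' ∧
      |extensionWeight c (G.IsTwoForest s t) K U' *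
          (c e * extensionWeight c G.IsSpanningTree (insert e K) U') -
        c e * extensionWeight c (G.IsTwoForest s t) (insert e K) U' *
          extensionWeight c G.IsSpanningTree K U'| ≤
      1 / (k + 1) * (extensionWeight c G.IsSpanningTree K U *
        extensionWeight c (G.IsTwoForest s t) K U) := by
  have hh := isVoltage_kirchhoffPotential hS.union_subset hS.disjoint hZ.ne' s t
  have hR := hh.sub_eq_div hS.union_subset hS.disjoint hZ.ne'
  obtain ⟨e, he, hle⟩ := hh.exists_mul_drop_sq_le (fun e he => (hS.pos e he).le)
    Finset.inter_subset_left (Finset.card_pos.mp (hk.trans_gt k.succ_pos))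
  rw [hR, hk, Nat.cast_succ] at hle
  obtain ⟨heU, heF⟩ := Finset.mem_inter.mp he
  have hce := (hS.pos e heU).le
  clear he
  obtain ⟨U', heU', rfl⟩ : ∃ U', e ∉ U' ∧ U = insert e U' :=
    ⟨U.erase e, Finset.notMem_erase e U, (Finset.insert_erase heU).symm⟩
  refine ⟨e, heF, U', heU', rfl, ?_⟩
  have hsq := hh.extensionWeight_mul_sub_mul_eq_sq hS.union_subset hS.disjoint heU' hS.pos hZ.ne'
  rw [mul_left_comm, mul_assoc, ← mul_sub, hsq, abs_of_nonneg (by positivity), mul_pow,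
    mul_left_comm]
  refine (mul_le_mul_of_nonneg_left hle (sq_nonneg _)).trans_eq ?_
  field_simp

end IsStage

/-- In all networks with `k` edges of `F` left to expose, the probability that a random spanning
tree satisfies `P` is at most `M * R ^ (-l) + err`, where `R` is the effective resistance between
`s` and `t`. -/
def TailBound (G : WeightedGraph V E) (F : Finset E) (s t : V) (P : Finset E → Prop) (l : ℝ)
    (k : ℕ) (M err : ℝ) : Prop :=
  ∀ ⦃c K U⦄, G.IsStage F c K U → (U ∩ F).card = k →
    RatioBound l M err (extensionWeight c (fun T => G.IsSpanningTree T ∧ P T) K U)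
      (extensionWeight c G.IsSpanningTree K U) (extensionWeight c (G.IsTwoForest s t) K U)

namespace TailBound

lemma mono (h : G.TailBound F s t P l k M err) (hM : M ≤ M') :
    G.TailBound F s t P l k M' err := by
  intro c K U hS hk hZ hΦ
  refine (h hS hk hZ hΦ).trans ?_
  gcongr

lemma of_one (hM : 0 ≤ M) : G.TailBound F s t P l k M 1 := by
  intro c K U hS _ hZ hΦ
  calc extensionWeight c (fun T => G.IsSpanningTree T ∧ P T) K U
      ≤ 1 * extensionWeight c G.IsSpanningTree K U := by
        rw [one_mul]
        exact extensionWeight_mono (fun e he => (hS.pos e he).le) fun X _ => And.left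
    _ ≤ _ := by gcongr; exact le_add_of_nonneg_left (by positivity)

lemma of_forall_pow (h : ∀ j : ℕ, G.TailBound F s t P l k M ((3 / 4) ^ j)) :
    G.TailBound F s t P l k M 0 := by
  intro c K U hS hk hZ hΦ
  have hlim := tendsto_pow_atTop_nhds_zero_of_lt_one (r := (3 / 4 : ℝ)) (by norm_num) (by norm_num)
  exact ge_of_tendsto' ((hlim.const_add _).mul_const _) fun j => h j hS hk hZ hΦ

/-- Where deleting `e` is the likelier alternative, the network is the average of the one with `e`
deleted and the one with the conductance of `e` doubled; otherwise, of the one with `e` contracted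
and the one with the conductance of `e` halved. Only the second network carries the error term. -/
lemma step (hl : 1 ≤ l) (hlk : l * (1 / (k + 1)) ≤ 1 / 11)
    (hM : M ≤ M' * Real.exp (-(48 * (l * (1 / (k + 1))) ^ 2))) (hM' : 0 ≤ M') (herr : 0 ≤ err)
    (h₀ : G.TailBound F s t P l k M 0) (h₁ : G.TailBound F s t P l (k + 1) M' err) :
    G.TailBound F s t P l (k + 1) M' (3 / 4 * err) := by
  intro c K U hS hk hZ
  obtain ⟨e, heF, U, heU, rfl, hcorr⟩ := hS.exists_correlation_le hk hZ s t
  have hce : 0 < c e := hS.pos e (Finset.mem_insert_self e U)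
  have hk' : (U ∩ F).card = k := by
    rw [Finset.insert_inter_of_mem heF, Finset.card_insert_of_notMem (by simp [heU])] at hk
    exact Nat.succ_injective hk
  have hdel := h₀ (hS.delete heF) hk'
  have hcon := (h₀ (hS.contract heF heU) hk').const_mul hce
  have hupd (a : ℝ) (ha : 0 < a) := h₁ (hS.update heF ha) hk
  simp only [extensionWeight_update_insert _ _ heU] at hupd
  simp only [extensionWeight_insert _ _ _ heU] at hZ hcorr ⊢
  have hc (f : E) (hf : f ∈ U) : 0 ≤ c f := ((hS.delete heF).pos f hf).le
  have htwice (x y : ℝ) : x + 2 * c e * y = x + 2 * (c e * y) := by ring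
  have hhalf (x y : ℝ) : 2 * (x + c e / 2 * y) = c e * y + 2 * x := by ring
  refine RatioBound.add_of_scaled hl hlk hM hM' herr (extensionWeight_nonneg hc)
    (mul_nonneg hce.le (extensionWeight_nonneg hc)) hcorr hdel hcon ?_ ?_ hZ
  · simpa only [hhalf] using (hupd (c e / 2) (by positivity)).const_mul two_pos
  · simpa only [htwice] using hupd (2 * c e) (by positivity)

lemma succ (hl : 1 ≤ l) (hlk : l * (1 / (k + 1)) ≤ 1 / 11) (hM : 0 ≤ M)
    (h : G.TailBound F s t P l k M 0) :
    G.TailBound F s t P l (k + 1) (M * Real.exp (48 * (l * (1 / (k + 1))) ^ 2)) 0 := by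
  have hM' : 0 ≤ M * Real.exp (48 * (l * (1 / (k + 1))) ^ 2) := by positivity
  refine of_forall_pow fun j => ?_
  induction j with
  | zero => exact of_one hM'
  | succ j ih =>
    rw [pow_succ' _ j]
    refine step hl hlk (le_of_eq ?_) hM' (by positivity) h ih
    rw [mul_assoc, ← Real.exp_add, add_neg_cancel, Real.exp_zero, mul_one]

/-- The factors `exp (48 * l ^ 2 / (k + 1) ^ 2)` lost in each step are controlled by the telescoping
sum `∑ k ≥ m, (1 / k - 1 / (k + 1)) = 1 / m`. -/
lemma of_le {m : ℕ} (hl : 1 ≤ l) (hm : 0 < m) (hlm : l / m ≤ 1 / 11) (hM : 0 ≤ M)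
    (h : ∀ k ≤ m, G.TailBound F s t P l k M 0) (k : ℕ) :
    G.TailBound F s t P l k (M * Real.exp (48 * l ^ 2 / m)) 0 := by
  have hm' : (0 : ℝ) < m := Nat.cast_pos.mpr hm
  rcases le_total k m with hkm | hmk
  · refine (h k hkm).mono (le_mul_of_one_le_right hM (Real.one_le_exp (by positivity)))
  suffices hk : G.TailBound F s t P l k (M * Real.exp (48 * l ^ 2 * (1 / m - 1 / k))) 0 by
    refine hk.mono ?_
    rw [div_eq_mul_one_div (48 * l ^ 2)]
    gcongr
    exact sub_le_self _ (by positivity)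
  induction k, hmk using Nat.le_induction with
  | base => simpa using h m le_rfl
  | succ k hmk ih =>
    have hmk' : (m : ℝ) ≤ k := Nat.cast_le.mpr hmk
    have hk : (0 : ℝ) < k := hm'.trans_le hmk'
    have hlk : l * (1 / (k + 1)) ≤ 1 / 11 := by
      rw [mul_one_div]
      exact le_trans (by gcongr; linarith) hlm
    refine (succ hl hlk (by positivity) ih).mono ?_
    rw [mul_assoc, ← Real.exp_add, mul_pow, ← mul_assoc, ← mul_add, Nat.cast_succ]
    gcongr
    have htelescope : (1 / (k + 1) : ℝ) ^ 2 ≤ 1 / k - 1 / (k + 1) := by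
      rw [div_sub_div _ _ hk.ne' (by positivity), div_pow, div_le_div_iff₀ (by positivity)
        (by positivity)]
      linarith
    linarith

end TailBound

end Stage

/-! ### Random spanning trees -/

section RandomTree

variable {G : WeightedGraph V E} {T : Finset E} {P Q : Finset E → Prop}

lemma prod_cond_nonneg (hT : T ∈ G.spanningTrees) : 0 ≤ ∏ e ∈ T, G.cond e := by
  classical
  exact Finset.prod_nonneg fun e he =>
    (G.cond_pos e (Finset.mem_powerset.mp (Finset.mem_filter.mp hT).1 he)).le

lemma treeProb_nonneg (G : WeightedGraph V E) (P : Finset E → Prop) : 0 ≤ G.treeProb P := by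
  classical
  exact div_nonneg (Finset.sum_nonneg fun T hT => prod_cond_nonneg (Finset.mem_filter.mp hT).1)
    (Finset.sum_nonneg fun T hT => prod_cond_nonneg hT)

lemma treeProb_mono (h : ∀ T, P T → Q T) :
    G.treeProb P ≤ G.treeProb Q := by
  classical
  refine div_le_div_of_nonneg_right (Finset.sum_le_sum_of_subset_of_nonneg ?_ fun T hT _ => ?_)
    (Finset.sum_nonneg fun T hT => prod_cond_nonneg hT)
  · exact Finset.monotone_filter_right _ fun T _ => h T
  · exact prod_cond_nonneg (Finset.mem_filter.mp hT).1

variable [DecidableEq E]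

lemma Connected.extensionWeight_isSpanningTree_pos (hG : G.Connected) :
    0 < extensionWeight G.cond G.IsSpanningTree ∅ G.edges := by
  obtain ⟨T, hT⟩ := hG.exists_isSpanningTree
  exact (extensionWeight_pos_iff G.cond_pos).mpr ⟨T, hT.1, by rwa [Finset.empty_union]⟩

lemma one_sub_le_treeProb {θ : ℝ}
    (hZ : 0 < extensionWeight G.cond G.IsSpanningTree ∅ G.edges)
    (hP : extensionWeight G.cond (fun T => G.IsSpanningTree T ∧ ¬ P T) ∅ G.edges ≤
      θ * extensionWeight G.cond G.IsSpanningTree ∅ G.edges) :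
    1 - θ ≤ G.treeProb P := by
  classical
  have hweight (Q : Finset E → Prop) [DecidablePred Q] :
      extensionWeight G.cond (fun T => G.IsSpanningTree T ∧ Q T) ∅ G.edges =
        ∑ T ∈ G.spanningTrees with Q T, ∏ e ∈ T, G.cond e := by
    rw [spanningTrees, Finset.filter_filter, Finset.sum_filter, extensionWeight]
    simp only [Finset.empty_union]
  have htotal : extensionWeight G.cond G.IsSpanningTree ∅ G.edges =
      ∑ T ∈ G.spanningTrees, ∏ e ∈ T, G.cond e := by
    simpa only [and_true, Finset.filter_true] using hweight fun _ => True
  rw [htotal] at hZ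
  rw [hweight, htotal] at hP
  have hsplit := Finset.sum_filter_add_sum_filter_not G.spanningTrees P (fun T => ∏ e ∈ T, G.cond e)
  rw [treeProb, le_div_iff₀ hZ]
  linarith

end RandomTree

/-! ### Robust trees -/

section Robust

variable {G : WeightedGraph V E} {F : Finset E} {s t : V} {h : V → ℝ} {m : ℕ} {ρ l ε : ℝ}

/-- After the edges of `F` have been exposed, deleting at most `m` of them makes the effective
resistance at least `ρ`. -/
def IsRobust (G : WeightedGraph V E) (F : Finset E) (s t : V) (m : ℕ) (ρ : ℝ) (T : Finset E) :
    Prop :=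
  ∃ F' ⊆ F, F'.card ≤ m ∧
    ENNReal.ofReal ρ ≤ (G.conditionDelete F T F').Reff (Quotient.mk _ s) (Quotient.mk _ t)

lemma isRobust_of_nonpos (hρ : ρ ≤ 0) (T : Finset E) : G.IsRobust F s t m ρ T :=
  ⟨∅, Finset.empty_subset F, m.zero_le, by rw [ENNReal.ofReal_of_nonpos hρ]; exact zero_le⟩

lemma IsStage.isRobust [DecidableEq E] {c : E → ℝ} {K U X : Finset E} (hS : G.IsStage F c K U)
    (hh : G.IsVoltage c K U s t h) (hcard : (U ∩ F).card ≤ m) (hXU : X ⊆ U) (hρ : ρ ≤ h s - h t)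
    (hst : 0 < h s - h t) : G.IsRobust F s t m ρ (K ∪ X) := by
  refine ⟨U ∩ F, Finset.inter_subset_right, hcard,
    ofReal_le_Reff_conditionDelete (hh.flatOn.mono ?_) (sub_pos.mp hst).ne' ?_
      Finset.inter_subset_right⟩
  · intro e he
    have := @hXU e
    simp only [Finset.mem_sdiff, Finset.mem_inter, Finset.mem_union] at he
    tauto
  · have hform : G.dirichletForm G.cond (G.edges \ F) h h ≤ h s - h t := by
      rw [← hh.apply_eq h hh.flatOn, dirichletForm_apply, dirichletForm_apply]
      calc ∑ e ∈ G.edges \ F, G.cond e * (G.drop e h * G.drop e h)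
          = ∑ e ∈ G.edges \ F, c e * (G.drop e h * G.drop e h) :=
            Finset.sum_congr rfl fun e he => by rw [hS.cond_eq e (Finset.mem_sdiff.mp he).2]
        _ ≤ _ := Finset.sum_le_sum_of_subset_of_nonneg hS.sdiff_subset fun e he _ =>
            mul_nonneg (hS.pos e he).le (mul_self_nonneg _)
    have hnonneg : 0 ≤ G.dirichletForm G.cond (G.edges \ F) h h :=
      dirichletForm_self_nonneg (fun e he => (G.cond_pos e (Finset.mem_sdiff.mp he).1).le) h
    rw [sq]
    gcongr

lemma tailBound_not_isRobust_of_le [DecidableEq E] {k : ℕ} (hl : 0 ≤ l) (hρ : 0 < ρ)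
    (hk : k ≤ m) :
    G.TailBound F s t (fun T => ¬ G.IsRobust F s t m ρ T) l k (ρ ^ l) 0 := by
  intro c K U hS hcard hZ hΦ
  have hc (e : E) (he : e ∈ U) : 0 ≤ c e := (hS.pos e he).le
  rw [add_zero, ← Real.mul_rpow hρ.le (by positivity)]
  have hh := isVoltage_kirchhoffPotential hS.union_subset hS.disjoint hZ.ne' s t
  have hR := hh.sub_eq_div hS.union_subset hS.disjoint hZ.ne'
  rcases le_total (extensionWeight c (G.IsTwoForest s t) K U)
    (ρ * extensionWeight c G.IsSpanningTree K U) with hle | hle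
  · refine (extensionWeight_mono hc fun X _ => And.left).trans (le_mul_of_one_le_left hZ.le ?_)
    refine Real.one_le_rpow ?_ hl
    rwa [← mul_div_assoc, one_le_div hΦ]
  · rw [extensionWeight_eq_zero fun X hXU hX => hX.2 <| hS.isRobust hh (hcard.trans_le hk) hXU
      (by rwa [hR, le_div_iff₀ hZ]) (by rw [hR]; positivity)]
    positivity

lemma one_sub_rpow_mul_exp_le_treeProb_isRobust (hG : G.Connected)
    (hh : G.IsVoltage G.cond ∅ G.edges s t h) (hst : 0 < h s - h t) (hρ : 0 < ρ) (hl : 1 ≤ l)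
    (hm : 0 < m) (hlm : l / m ≤ 1 / 11) :
    1 - (ρ / (h s - h t)) ^ l * Real.exp (48 * l ^ 2 / m) ≤ G.treeProb (G.IsRobust F s t m ρ) := by
  classical
  have hZ := hG.extensionWeight_isSpanningTree_pos
  have hS := G.isStage_edges F
  have hR := hh.sub_eq_div hS.union_subset hS.disjoint hZ.ne'
  rw [hR, div_pos_iff_of_pos_right hZ] at hst
  have htail := TailBound.of_le hl hm hlm (by positivity)
    (fun k hk => tailBound_not_isRobust_of_le (zero_le_one.trans hl) hρ hk)
    (G.edges ∩ F).card hS rfl hZ hst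
  refine one_sub_le_treeProb hZ (htail.trans_eq ?_)
  rw [hR, ← mul_one_div ρ, one_div_div, Real.mul_rpow hρ.le (by positivity)]
  ring

lemma one_sub_two_mul_exp_le_treeProb_isRobust (hG : G.Connected)
    (hh : G.IsVoltage G.cond ∅ G.edges s t h) (hε : 0 < ε) (hε1 : ε < 1) :
    1 - 2 * Real.exp (-(ε ^ 2 * m / 192)) ≤
      G.treeProb (G.IsRobust F s t m ((1 - ε) * (h s - h t))) := by
  classical
  obtain ⟨l, hl⟩ : ∃ l, l = ε * m / 96 := ⟨_, rfl⟩
  have hexp : ε ^ 2 * m / 192 = ε * l / 2 := by rw [hl]; ring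
  rw [hexp]
  have hε' : 0 < 1 - ε := sub_pos.mpr hε1
  rcases lt_or_ge l 1 with hl1 | hl1
  · refine le_trans ?_ (treeProb_nonneg G _)
    nlinarith [Real.add_one_le_exp (-(ε * l / 2))]
  rcases (hh.sub_nonneg fun e he => (G.cond_pos e he).le).eq_or_lt with hR | hR
  · rw [← hR, mul_zero]
    refine one_sub_le_treeProb hG.extensionWeight_isSpanningTree_pos ?_
    rw [extensionWeight_eq_zero fun X _ hX => hX.2 (isRobust_of_nonpos le_rfl _)]
    have := hG.extensionWeight_isSpanningTree_pos
    positivity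
  have hm : 0 < m := Nat.pos_of_ne_zero fun hm => by norm_num [hl, hm] at hl1
  have hlm : l / m = ε / 96 := by rw [hl]; field_simp
  refine le_trans ?_ (one_sub_rpow_mul_exp_le_treeProb_isRobust hG hh hR (mul_pos hε' hR) hl1 hm
    (by linarith))
  have hpow : (1 - ε) ^ l ≤ Real.exp (-(ε * l)) := by
    rw [← neg_mul, Real.exp_mul]
    exact Real.rpow_le_rpow hε'.le (Real.one_sub_le_exp_neg ε) (by linarith)
  have hdrift : 48 * l ^ 2 / m = ε * l / 2 := by linear_combination 48 * l * hlm
  rw [mul_div_cancel_right₀ _ hR.ne', hdrift]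
  refine sub_le_sub_left ?_ 1
  calc (1 - ε) ^ l * Real.exp (ε * l / 2) ≤ Real.exp (-(ε * l)) * Real.exp (ε * l / 2) := by gcongr
    _ = Real.exp (-(ε * l / 2)) := by rw [← Real.exp_add]; ring_nf
    _ ≤ 2 * Real.exp (-(ε * l / 2)) := by linarith [Real.exp_pos (-(ε * l / 2))]

theorem one_sub_two_mul_exp_le_treeProb (hG : G.Connected) (F : Finset E) (s t : V) (m : ℕ)
    (hε : 0 < ε) (hε1 : ε < 1) :
    1 - 2 * Real.exp (-(ε ^ 2 * m / 192)) ≤ G.treeProb fun T => ∃ F' ⊆ F, F'.card ≤ m ∧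
      ENNReal.ofReal (1 - ε) * G.Reff s t ≤
        (G.conditionDelete F T F').Reff (Quotient.mk _ s) (Quotient.mk _ t) := by
  classical
  have hh := isVoltage_kirchhoffPotential (Finset.empty_union G.edges).subset
    (Finset.disjoint_empty_left _) hG.extensionWeight_isSpanningTree_pos.ne' s t
  refine (one_sub_two_mul_exp_le_treeProb_isRobust hG hh hε hε1).trans
    (treeProb_mono fun T ⟨F', hF', hcard, hle⟩ => ⟨F', hF', hcard, le_trans ?_ hle⟩)
  rw [ENNReal.ofReal_mul (sub_pos.mpr hε1).le]
  gcongr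
  exact hh.Reff_le

end Robust

lemma two_mul_exp_neg_floor_le_rpow_neg {a ε n : ℝ} (hε : 0 < ε) (hε1 : ε < 1)
    (hn : 2 ≤ n) :
    2 * Real.exp (-(ε ^ 2 * ⌊192 * (a + 2) * Real.log n / ε ^ 2⌋₊ / 192)) ≤ n ^ (-a) := by
  have hlog : Real.log 2 ≤ Real.log n := Real.log_le_log two_pos hn
  have hlog2 := Real.log_two_gt_d9
  have hfloor := mul_le_mul_of_nonneg_left
    (Nat.lt_floor_add_one (192 * (a + 2) * Real.log n / ε ^ 2)).le (sq_nonneg ε)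
  rw [mul_div_cancel₀ _ (pow_ne_zero 2 hε.ne')] at hfloor
  rw [← Real.exp_log two_pos, ← Real.exp_add, Real.rpow_def_of_pos (by linarith),
    Real.exp_log two_pos, Real.exp_le_exp]
  nlinarith

end WeightedGraph

theorem mainTheorem3 (a : ℝ) (ha : 0 < a) :
    ∃ C : ℝ, 0 < C ∧
      ∀ (V : Type*) (E : Type*) [Fintype V] (G : WeightedGraph V E) (_ : G.Connected)
        (F : Finset E) (_ : F ⊆ G.edges) (ε : ℝ) (_ : 0 < ε) (_ : ε < 1) (s t : V),
        1 - (Fintype.card V : ℝ) ^ (-a) ≤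
          G.treeProb fun T =>
            ∃ F' : Finset E, F' ⊆ F ∧
              ENNReal.ofReal (1 - ε) * G.Reff s t ≤
                (G.conditionDelete F T F').Reff (Quotient.mk _ s) (Quotient.mk _ t) ∧
              (F'.card : ℝ) ≤ C * Real.log (Fintype.card V) / ε ^ 2 := by
  refine ⟨192 * (a + 2), by positivity, fun V E _ G hG F _ ε hε hε1 s t => ?_⟩
  have hcard : 1 ≤ Fintype.card V := Fintype.card_pos_iff.mpr ⟨s⟩
  rcases hcard.eq_or_lt with hV | hV
  · rw [← hV, Nat.cast_one, Real.one_rpow, sub_self]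
    exact G.treeProb_nonneg _
  · refine (sub_le_sub_left (WeightedGraph.two_mul_exp_neg_floor_le_rpow_neg hε hε1
      (Nat.ofNat_le_cast.mpr hV)) 1).trans ?_
    refine (WeightedGraph.one_sub_two_mul_exp_le_treeProb hG F s t _ hε hε1).trans ?_
    exact WeightedGraph.treeProb_mono fun T ⟨F', hF', hF'card, hReff⟩ =>
      ⟨F', hF', hReff, (Nat.le_floor_iff (by positivity)).mp hF'card⟩
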